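/- Let $X$ be an infinite-dimensional complex Banach space and let $A$ be a closed, densely defined linear operator on $X$ with domain $\mathcal D(A)$, null space $\mathcal N(A)$ and range $\mathcal R(A)$. The powers $A^n$ ($n\ge 0$) are taken on their natural domains $\mathcal D(A^n)=\{x\in X: x,Ax,\dots,A^{n-1}x\in\mathcal D(A)\}$, with $A^0=I$ on $\mathcal D(A^0)=X$. An operator is called Fredholm if its range is closed and of finite codimension and its null space is finite-dimensional; it is called Browder if it is Fredholm and has finite ascent ($\mathcal N(A^n)=\mathcal N(A^{n+1})$ for some $n\ge 0$) and finite descent ($\mathcal R(A^n)=\mathcal R(A^{n+1})$ for some $n\ge 0$). Put $\sigma_e(A)=\{\lambda\in\mathbb C: A-\lambda \text{ is not Fredholm}\}$, $\rho_e(A)=\mathbb C\setminus\sigma_e(A)$ and $\sigma_b(A)=\{\lambda\in\mathbb C: A-\lambda\text{ is not Browder}\}$. A bounded operator $T$ on $X$ is called Riesz if $\sigma_e(T)=\{0\}$. The operator $A$ is called generalized Drazin-Riesz invertible if there is a bounded operator $B$ on $X$ such that $\mathcal R(B)\subset\mathcal D(A)$, $\mathcal R(I-AB)\subset\mathcal D(A)$,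 $BAB=B$, $BAx=ABx$ for all $x\in\mathcal D(A)$, and $A(I-AB)$ is a bounded Riesz operator. Assume that $\rho_e(A)\neq\emptyset$ and that $\mathcal D(A^{j+1})=\mathcal D(A^j)$ for all sufficiently large $j$. Then the following are equivalent: (i) $A$ is generalized Drazin-Riesz invertible; (ii) $0$ is not an accumulation point of $\sigma_b(A)$. -/

import Mathlib

open Filter Topology

namespace UnboundedOp

variable {X : Type*} [NormedAddCommGroup X] [NormedSpace ℂ X]

/-- The natural domain `{x ∈ D(f) : f x ∈ D(g)}` of the composition `g ∘ f`. -/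
def compDomain (g f : X →ₗ.[ℂ] X) : Submodule ℂ X :=
  (g.domain.comap f.toFun).map f.domain.subtype

theorem mem_compDomain {g f : X →ₗ.[ℂ] X} {x : X} :
    x ∈ compDomain g f ↔ ∃ h : x ∈ f.domain, f ⟨x, h⟩ ∈ g.domain := by
  constructor
  · rintro ⟨y, hy, rfl⟩
    exact ⟨y.2, hy⟩
  · rintro ⟨h, hx⟩
    exact ⟨⟨x, h⟩, hx, rfl⟩

/-- The composition `g ∘ f` of two partially defined operators on its natural domain. -/
def comp (g f : X →ₗ.[ℂ] X) : X →ₗ.[ℂ] X where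
  domain := compDomain g f
  toFun :=
    { toFun := fun x => g ⟨f ⟨x, (mem_compDomain.1 x.2).1⟩, (mem_compDomain.1 x.2).2⟩
      map_add' := fun x y => by
        rw [← LinearPMap.map_add]
        congr 1
        exact Subtype.ext (LinearPMap.map_add f
          ⟨x, (mem_compDomain.1 x.2).1⟩ ⟨y, (mem_compDomain.1 y.2).1⟩)
      map_smul' := fun c x => by
        rw [RingHom.id_apply, ← LinearPMap.map_smul]
        congr 1
        exact Subtype.ext (LinearPMap.map_smul f c ⟨x, (mem_compDomain.1 x.2).1⟩) }

/-- The powers of an operator, `D(A ^ n) = {x : x, A x, …, A ^ (n - 1) x ∈ D(A)}`; the power `0` is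
the identity on the whole space. -/
def pow (A : X →ₗ.[ℂ] X) : ℕ → (X →ₗ.[ℂ] X)
  | 0 => (LinearMap.id : X →ₗ[ℂ] X).toPMap ⊤
  | n + 1 => comp A (pow A n)

/-- The operator `A - μ`, with domain `D(A)`. -/
def subScalar (A : X →ₗ.[ℂ] X) (μ : ℂ) : X →ₗ.[ℂ] X :=
  (-(μ • (LinearMap.id : X →ₗ[ℂ] X))) +ᵥ A

/-- The null space `{x ∈ D(A) : A x = 0}`, as a subspace of `X`. -/
def nullSpace (A : X →ₗ.[ℂ] X) : Submodule ℂ X :=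
  (LinearMap.ker A.toFun).map A.domain.subtype

/-- The range `{A x : x ∈ D(A)}`. -/
def range (A : X →ₗ.[ℂ] X) : Submodule ℂ X :=
  LinearMap.range A.toFun

/-- Fredholm: closed range, finite-dimensional null space, range of finite codimension. -/
structure IsFredholm (A : X →ₗ.[ℂ] X) : Prop where
  isClosed_range : IsClosed (range A : Set X)
  finite_nullSpace : FiniteDimensional ℂ (nullSpace A)
  finite_coker : FiniteDimensional ℂ (X ⧸ range A)

def HasFiniteAscent (A : X →ₗ.[ℂ] X) : Prop :=
  ∃ n : ℕ, nullSpace (pow A n) = nullSpace (pow A (n + 1))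

def HasFiniteDescent (A : X →ₗ.[ℂ] X) : Prop :=
  ∃ n : ℕ, range (pow A n) = range (pow A (n + 1))

/-- Browder: Fredholm of finite ascent and finite descent. -/
structure IsBrowder (A : X →ₗ.[ℂ] X) : Prop where
  isFredholm : IsFredholm A
  finiteAscent : HasFiniteAscent A
  finiteDescent : HasFiniteDescent A

def essentialSpectrum (A : X →ₗ.[ℂ] X) : Set ℂ :=
  {μ | ¬ IsFredholm (subScalar A μ)}

def essentialResolvent (A : X →ₗ.[ℂ] X) : Set ℂ :=
  (essentialSpectrum A)ᶜ

def browderSpectrum (A : X →ₗ.[ℂ] X) : Set ℂ :=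
  {μ | ¬ IsBrowder (subScalar A μ)}

/-- A bounded operator is Riesz if its essential spectrum is `{0}`. -/
def IsRiesz (T : X →L[ℂ] X) : Prop :=
  essentialSpectrum ((T : X →ₗ[ℂ] X).toPMap ⊤) = {0}

/-- The bounded operator `B` is a generalized Drazin-Riesz inverse of `A`: the ranges of `B` and of
`I - A B` lie in `D(A)`, `B A B = B`, `B A x = A B x` for `x ∈ D(A)`, and `A (I - A B)` is a bounded
Riesz operator. -/
def IsGeneralizedDrazinRieszInverse (A : X →ₗ.[ℂ] X) (B : X →L[ℂ] X) : Prop :=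
  ∃ (hB : ∀ x : X, B x ∈ A.domain) (hAB : ∀ x : X, x - A ⟨B x, hB x⟩ ∈ A.domain),
    (∀ x : X, B (A ⟨B x, hB x⟩) = B x) ∧
    (∀ x : A.domain, B (A x) = A ⟨B x, hB x⟩) ∧
    ∃ T : X →L[ℂ] X, (∀ x : X, T x = A ⟨x - A ⟨B x, hB x⟩, hAB x⟩) ∧ IsRiesz T

def IsGeneralizedDrazinRieszInvertible (A : X →ₗ.[ℂ] X) : Prop :=
  ∃ B : X →L[ℂ] X, IsGeneralizedDrazinRieszInverse A B

end UnboundedOp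

/-!
If `A - μ` is Fredholm, the open mapping theorem for the graph of `A` over the closed, finitely
complemented range `R(A - μ)` shows that every `D(A ^ n)` is dense, hence
`D(A ^ n) + R(A - μ) = X`. An equality `D(A ^ (n + 2)) = D(A ^ (n + 1))` then forces
`D(A ^ (n + 1)) = D(A ^ n)`, so descending from large `n` gives `D(A) = X`, and `A` is bounded by
the closed graph theorem.

For a bounded `T`, a Fredholm `T - μ` with `μ` in the closure of the resolvent set is Browder: its
index is `0`, and it is injective on `⋂ R((T - μ) ^ n)`, on which it is a surjective limit of
injective operators. A Browder point is in turn isolated in the spectrum. If `B` is an outer inverse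
commuting with `T`, then for small `μ ≠ 0` the operators `T - μ` and `T (1 - T B) - μ` differ only
by an invertible factor; a Riesz operator is Browder away from `0` because `ℂ ∖ {0}` is connected,
so these `T - μ` are Browder. Conversely, suppose `T - μ` is Browder for all small `μ ≠ 0`. If `T`
is Fredholm, it is Browder, and the Drazin inverse leaves a nilpotent residual of finite rank, which
is Riesz since `X` is infinite-dimensional. Otherwise the spectrum of `T` misses a small annulus
about `0`, and the Laurent coefficient of `z ^ 0` of the resolvent there is, up to sign, an outer
inverse whose residual is Riesz.
-/

namespace UnboundedOp

section DenseSubspaces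

variable {𝕜 E : Type*} [NontriviallyNormedField 𝕜] [CompleteSpace 𝕜]
  [NormedAddCommGroup E] [NormedSpace 𝕜 E] {D R : Submodule 𝕜 E}

theorem codisjoint_of_dense (hD : Dense (D : Set E)) (hR : IsClosed (R : Set E))
    [FiniteDimensional 𝕜 (E ⧸ R)] : Codisjoint D R := by
  rw [codisjoint_iff, ← SetLike.coe_set_eq, Submodule.top_coe, ← (hD.mono
    (SetLike.coe_subset_coe.2 (le_sup_left : D ≤ D ⊔ R))).closure_eq]
  exact (Submodule.isClosed_mono_of_finiteDimensional_quotient hR le_sup_right).closure_eq.symm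

theorem dense_comap_subtype (hD : Dense (D : Set E)) (hR : IsClosed (R : Set E))
    [FiniteDimensional 𝕜 (E ⧸ R)] : Dense (D.comap R.subtype : Set R) := by
  obtain ⟨C, hCD, hC⟩ := (codisjoint_of_dense hD hR).exists_isCompl
  have hRC := Submodule.IsCompl.isTopCompl_of_finiteDimensional_quotient hC.symm hR
  set P := R.projectionOntoL C hRC
  refine ((Submodule.projectionOntoL_surjective hRC).denseRange.dense_image
    P.continuous hD).mono ?_
  rintro _ ⟨x, hx, rfl⟩
  have hxC : x - P x ∈ C := by
    rw [← Submodule.projectionOntoL_apply_eq_zero_iff hRC, map_sub,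
      Submodule.projectionOntoL_apply_left, sub_self]
  have hPx := sub_mem hx (hCD hxC)
  rwa [sub_sub_cancel] at hPx

end DenseSubspaces

section Domains

variable {X : Type*} [NormedAddCommGroup X] [NormedSpace ℂ X] {A : X →ₗ.[ℂ] X} {μ : ℂ} {n : ℕ}

theorem mem_graph_comp {g f : X →ₗ.[ℂ] X} {x y : X} :
    (x, y) ∈ (comp g f).graph ↔ ∃ z, (x, z) ∈ f.graph ∧ (z, y) ∈ g.graph := by
  simp only [LinearPMap.mem_graph_iff]
  constructor
  · rintro ⟨a, ha, hy⟩
    obtain ⟨h₁, h₂⟩ := mem_compDomain.1 a.2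
    exact ⟨f ⟨a, h₁⟩, ⟨⟨a, h₁⟩, ha, rfl⟩, ⟨⟨_, h₂⟩, rfl, hy⟩⟩
  · rintro ⟨z, ⟨a, rfl, rfl⟩, ⟨b, hb, rfl⟩⟩
    have hmem : (a : X) ∈ compDomain g f := mem_compDomain.2 ⟨a.2, hb ▸ b.2⟩
    refine ⟨⟨a, hmem⟩, rfl, ?_⟩
    change g ⟨f ⟨a, _⟩, _⟩ = g b
    congr 1
    exact Subtype.ext hb.symm

theorem mem_graph_pow_zero {x y : X} : (x, y) ∈ (pow A 0).graph ↔ x = y := by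
  simp [pow, LinearPMap.mem_graph_iff]

theorem mem_graph_pow_succ {x y : X} :
    (x, y) ∈ (pow A (n + 1)).graph ↔ ∃ z, (x, z) ∈ (pow A n).graph ∧ (z, y) ∈ A.graph :=
  mem_graph_comp

theorem mem_graph_pow_succ' {x y : X} :
    (x, y) ∈ (pow A (n + 1)).graph ↔ ∃ z, (x, z) ∈ A.graph ∧ (z, y) ∈ (pow A n).graph := by
  induction n generalizing y with
  | zero =>
    rw [mem_graph_pow_succ]
    simp only [mem_graph_pow_zero, exists_eq_left', exists_eq_right]
  | succ n ih =>
    rw [mem_graph_pow_succ]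
    simp only [ih, mem_graph_pow_succ]
    exact ⟨fun ⟨z, ⟨w, hw, hwz⟩, hz⟩ => ⟨w, hw, z, hwz, hz⟩,
      fun ⟨w, hw, z, hwz, hz⟩ => ⟨z, ⟨w, hw, hwz⟩, hz⟩⟩

theorem mem_domain_pow_succ {x : X} :
    x ∈ (pow A (n + 1)).domain ↔ ∃ z, (x, z) ∈ A.graph ∧ z ∈ (pow A n).domain := by
  simp only [LinearPMap.mem_domain_iff, mem_graph_pow_succ']
  exact ⟨fun ⟨y, z, hxz, hzy⟩ => ⟨z, hxz, y, hzy⟩, fun ⟨z, hxz, y, hzy⟩ => ⟨y, z, hxz, hzy⟩⟩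

theorem domain_pow_succ_le (A : X →ₗ.[ℂ] X) (n : ℕ) :
    (pow A (n + 1)).domain ≤ (pow A n).domain := by
  intro x hx
  obtain ⟨y, hy⟩ := LinearPMap.mem_domain_iff.1 hx
  obtain ⟨z, hz, -⟩ := mem_graph_pow_succ.1 hy
  exact LinearPMap.mem_domain_iff.2 ⟨z, hz⟩

theorem domain_pow_one (A : X →ₗ.[ℂ] X) : (pow A 1).domain = A.domain := by
  ext x
  rw [mem_domain_pow_succ, LinearPMap.mem_domain_iff]
  exact ⟨fun ⟨z, hxz, _⟩ => ⟨z, hxz⟩, fun ⟨z, hxz⟩ => ⟨z, hxz, trivial⟩⟩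

theorem mem_domain_pow_succ_iff_sub_smul_mem {x z : X} (hxz : (x, z) ∈ A.graph) :
    x ∈ (pow A (n + 1)).domain ↔ z - μ • x ∈ (pow A n).domain := by
  constructor
  · intro hx
    obtain ⟨z', hxz', hz'⟩ := mem_domain_pow_succ.1 hx
    obtain rfl : z = z' := A.mem_graph_snd_inj hxz hxz' rfl
    exact sub_mem hz' (Submodule.smul_mem _ μ (domain_pow_succ_le A n hx))
  · intro hz
    induction n with
    | zero => exact mem_domain_pow_succ.2 ⟨z, hxz, trivial⟩
    | succ n ih =>
      have hx := ih (domain_pow_succ_le A n hz)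
      refine mem_domain_pow_succ.2 ⟨z, hxz, ?_⟩
      simpa using add_mem hz (Submodule.smul_mem _ μ hx)

theorem subScalar_apply (A : X →ₗ.[ℂ] X) (μ : ℂ) (x : A.domain) :
    (subScalar A μ).toFun x = A x - μ • (x : X) := by
  change (-(μ • (LinearMap.id : X →ₗ[ℂ] X))) x + A x = _
  simp [sub_eq_neg_add]

theorem mem_range_subScalar {y : X} :
    y ∈ range (subScalar A μ) ↔ ∃ x z, (x, z) ∈ A.graph ∧ z - μ • x = y := by
  constructor
  · rintro ⟨x, rfl⟩
    exact ⟨_, _, A.mem_graph x, (subScalar_apply A μ x).symm⟩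
  · rintro ⟨x, z, h, rfl⟩
    obtain ⟨a, rfl, rfl⟩ := (LinearPMap.mem_graph_iff _).1 h
    exact ⟨a, subScalar_apply A μ a⟩

/-- The operator `A - μ` as a bounded operator from the graph of `A` onto the range of `A - μ`. -/
noncomputable def graphSubScalar (A : X →ₗ.[ℂ] X) (μ : ℂ) :
    A.graph →L[ℂ] range (subScalar A μ) :=
  ((ContinuousLinearMap.snd ℂ X X - μ • ContinuousLinearMap.fst ℂ X X) ∘L
    A.graph.subtypeL).codRestrict _ fun p => mem_range_subScalar.2 ⟨_, _, p.2, rfl⟩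

theorem graphSubScalar_surjective (A : X →ₗ.[ℂ] X) (μ : ℂ) :
    Function.Surjective (graphSubScalar A μ) := by
  rintro ⟨y, hy⟩
  obtain ⟨x, z, hxz, rfl⟩ := mem_range_subScalar.1 hy
  exact ⟨⟨(x, z), hxz⟩, rfl⟩

theorem isOpenMap_graphSubScalar [CompleteSpace X] (hA : A.IsClosed)
    (hR : IsClosed (range (subScalar A μ) : Set X)) : IsOpenMap (graphSubScalar A μ) :=
  have : CompleteSpace A.graph := (show IsClosed (A.graph : Set (X × X)) from hA).completeSpace_coe
  have : CompleteSpace (range (subScalar A μ)) := hR.completeSpace_coe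
  (graphSubScalar A μ).isOpenMap (graphSubScalar_surjective A μ)

theorem dense_domain_pow [CompleteSpace X] (hA : A.IsClosed) (hdense : Dense (A.domain : Set X))
    (hμ : IsFredholm (subScalar A μ)) (n : ℕ) : Dense ((pow A n).domain : Set X) := by
  induction n with
  | zero => exact dense_univ
  | succ n ih =>
    have := hμ.finite_coker
    set D := (pow A n).domain.comap (range (subScalar A μ)).subtype
    have hgraph : Dense (graphSubScalar A μ ⁻¹' D) :=
      (dense_comap_subtype ih hμ.isClosed_range).preimage
        (isOpenMap_graphSubScalar hA hμ.isClosed_range)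
    have hfst : Dense (Set.range fun p : A.graph => p.1.1) :=
      hdense.mono fun x hx => ⟨⟨_, A.mem_graph ⟨x, hx⟩⟩, rfl⟩
    refine (DenseRange.dense_image hfst (by fun_prop) hgraph).mono ?_
    rintro _ ⟨p, hp, rfl⟩
    exact (mem_domain_pow_succ_iff_sub_smul_mem p.2).2 hp

theorem domain_pow_succ_eq_of_succ [CompleteSpace X] (hA : A.IsClosed)
    (hdense : Dense (A.domain : Set X)) (hμ : IsFredholm (subScalar A μ))
    (h : (pow A (n + 2)).domain = (pow A (n + 1)).domain) :
    (pow A (n + 1)).domain = (pow A n).domain := by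
  refine le_antisymm (domain_pow_succ_le A n) fun x hx => ?_
  have := hμ.finite_coker
  have hx' : x ∈ (pow A (n + 1)).domain ⊔ range (subScalar A μ) :=
    (codisjoint_of_dense (dense_domain_pow hA hdense hμ (n + 1)) hμ.isClosed_range).eq_top ▸ trivial
  obtain ⟨d, hd, y, hy, rfl⟩ := Submodule.mem_sup.1 hx'
  obtain ⟨u, v, huv, rfl⟩ := mem_range_subScalar.1 hy
  have hu : u ∈ (pow A (n + 1)).domain :=
    (mem_domain_pow_succ_iff_sub_smul_mem huv).2 <| by
      simpa using sub_mem hx (domain_pow_succ_le A n hd)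
  exact add_mem hd ((mem_domain_pow_succ_iff_sub_smul_mem huv).1 (h ▸ hu))

theorem domain_eq_top [CompleteSpace X] (hA : A.IsClosed) (hdense : Dense (A.domain : Set X))
    (hess : (essentialResolvent A).Nonempty)
    (hdom : ∀ᶠ j : ℕ in atTop, (pow A (j + 1)).domain = (pow A j).domain) : A.domain = ⊤ := by
  obtain ⟨μ, hμ⟩ := hess
  obtain ⟨n, hn⟩ := hdom.exists
  rw [← domain_pow_one]
  induction n with
  | zero => exact hn
  | succ n ih => exact ih (domain_pow_succ_eq_of_succ hA hdense (not_not.1 hμ) hn)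

end Domains

section Bounded

variable {X : Type*} [NormedAddCommGroup X] [NormedSpace ℂ X]

/-- A bounded operator, regarded as an operator with domain the whole space. -/
abbrev ofBounded (T : X →L[ℂ] X) : X →ₗ.[ℂ] X :=
  (T : X →ₗ[ℂ] X).toPMap ⊤

theorem exists_eq_ofBounded [CompleteSpace X] {A : X →ₗ.[ℂ] X} (hA : A.IsClosed)
    (h : A.domain = ⊤) : ∃ T : X →L[ℂ] X, A = ofBounded T := by
  let f : X →ₗ[ℂ] X := A.toFun ∘ₗ (LinearMap.id.codRestrict A.domain fun _ => h ▸ trivial)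
  have hf : f.toPMap ⊤ = A := LinearPMap.ext h.symm fun x _ _ => rfl
  have hgraph : (f.graph : Set (X × X)) = A.graph := by
    ext ⟨x, y⟩
    rw [← hf]
    simp [LinearMap.mem_graph_iff, LinearPMap.mem_graph_iff, eq_comm]
  exact ⟨⟨f, f.continuous_of_isClosed_graph (hgraph ▸ hA)⟩, hf.symm⟩

theorem range_ofBounded (T : X →L[ℂ] X) : range (ofBounded T) = T.range := by
  ext y
  exact ⟨fun ⟨x, hx⟩ => ⟨x, hx⟩, fun ⟨x, hx⟩ => ⟨⟨x, trivial⟩, hx⟩⟩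

theorem nullSpace_ofBounded (T : X →L[ℂ] X) : nullSpace (ofBounded T) = T.ker := by
  ext y
  exact ⟨fun ⟨_, hx, hxy⟩ => hxy ▸ hx, fun hy => ⟨⟨y, trivial⟩, hy, rfl⟩⟩

theorem subScalar_ofBounded (T : X →L[ℂ] X) (μ : ℂ) :
    subScalar (ofBounded T) μ = ofBounded (T - μ • 1) :=
  LinearPMap.ext rfl fun x _ _ => subScalar_apply (ofBounded T) μ ⟨x, trivial⟩

theorem pow_ofBounded (T : X →L[ℂ] X) (n : ℕ) : pow (ofBounded T) n = ofBounded (T ^ n) := by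
  refine LinearPMap.eq_of_eq_graph ?_
  induction n with
  | zero => ext ⟨x, y⟩; simp [pow]
  | succ n ih =>
    ext ⟨x, y⟩
    rw [mem_graph_pow_succ, ih]
    simp [pow_succ']

end Bounded

section Fredholm

variable {𝕜 E F G : Type*} [NontriviallyNormedField 𝕜] [NormedAddCommGroup E] [NormedSpace 𝕜 E]
  [NormedAddCommGroup F] [NormedSpace 𝕜 F] [NormedAddCommGroup G] [NormedSpace 𝕜 G]

theorem not_isFredholm_of_finiteDimensional_range {u : E →L[𝕜] F} (h : ¬ FiniteDimensional 𝕜 E)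
    [FiniteDimensional 𝕜 u.range] : ¬ u.IsFredholm := by
  intro hu
  have := hu.finite_ker
  have : FiniteDimensional 𝕜 (E ⧸ u.ker) := u.quotKerEquivRange.symm.finiteDimensional
  exact h (Module.Finite.of_submodule_quotient u.ker)

variable [CompleteSpace 𝕜]

theorem isFredholm_comp {v : F →L[𝕜] G} {u : E →L[𝕜] F} (hv : v.IsFredholm) (hu : u.IsFredholm) :
    (v ∘L u).IsFredholm := by
  obtain ⟨v', hv'⟩ := hv.exists_isQuasiInverse
  obtain ⟨u', hu'⟩ := hu.exists_isQuasiInverse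
  exact .of_isQuasiInverse (v := u' ∘L v') (hu'.comp hv')

theorem isFredholm_of_isUnit {u : E →L[𝕜] E} (hu : IsUnit u) : u.IsFredholm := by
  obtain ⟨e, rfl⟩ := hu
  exact .of_isQuasiInverse (v := ↑e⁻¹)
    (ContinuousLinearEquiv.unitsEquiv 𝕜 E e).toLinearEquiv.isQuasiInverse

theorem isFredholm_pow {u : E →L[𝕜] E} (hu : u.IsFredholm) (n : ℕ) : (u ^ n).IsFredholm := by
  induction n with
  | zero => exact isFredholm_of_isUnit isUnit_one
  | succ n ih => exact isFredholm_comp ih hu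

end Fredholm

section FredholmBanach

variable {𝕜 E F : Type*} [RCLike 𝕜] [NormedAddCommGroup E] [NormedSpace 𝕜 E] [CompleteSpace E]
  [NormedAddCommGroup F] [NormedSpace 𝕜 F] [CompleteSpace F]

theorem isFredholm_of_isClosed_range {u : E →L[𝕜] F} (hu : IsClosed (u.range : Set F))
    (hker : FiniteDimensional 𝕜 u.ker) (hcoker : FiniteDimensional 𝕜 (F ⧸ u.range)) :
    u.IsFredholm where
  isStrictMap := by
    have : CompleteSpace u.range := hu.completeSpace_coe
    let v : E →L[𝕜] u.range := u.codRestrict u.range fun x => ⟨x, rfl⟩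
    have hv : Function.Surjective v := fun ⟨_, x, hx⟩ => ⟨x, Subtype.ext hx⟩
    exact LinearMap.isStrictMap_iff_isOpenQuotientMap_rangeRestrict.2
      ⟨hv, v.continuous, v.isOpenMap hv⟩
  isClosed_range := hu
  finite_ker := hker
  finite_coker := hcoker
  closedComplemented_ker := .of_finiteDimensional _

theorem isFredholm_of_mul_of_mul {u v : E →L[𝕜] E} (huv : (u * v).IsFredholm)
    (hvu : (v * u).IsFredholm) : u.IsFredholm := by
  have hrange : (u * v).range ≤ u.range := LinearMap.range_comp_le_range _ _
  have hker : u.ker ≤ (v * u).ker := LinearMap.ker_le_ker_comp _ _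
  have := huv.finite_coker
  have := hvu.finite_ker
  exact isFredholm_of_isClosed_range
    (Submodule.isClosed_mono_of_finiteDimensional_quotient huv.isClosed_range hrange)
    (Submodule.finiteDimensional_of_le hker) (huv.finite_coker.of_le hrange)

theorem isFredholm_ofBounded_iff {X : Type*} [NormedAddCommGroup X] [NormedSpace ℂ X]
    [CompleteSpace X] {T : X →L[ℂ] X} : IsFredholm (ofBounded T) ↔ T.IsFredholm := by
  constructor
  · rintro ⟨h₁, h₂, h₃⟩
    rw [range_ofBounded] at h₁ h₃
    rw [nullSpace_ofBounded] at h₂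
    exact isFredholm_of_isClosed_range h₁ h₂ h₃
  · rintro ⟨-, h₁, h₂, h₃⟩
    rw [← range_ofBounded] at h₁ h₃
    rw [← nullSpace_ofBounded] at h₂
    exact ⟨h₁, h₂, h₃⟩

end FredholmBanach

section Index

open ContinuousLinearMap

variable {𝕜 E F : Type*} [NontriviallyNormedField 𝕜] [NormedAddCommGroup E] [NormedSpace 𝕜 E]
  [NormedAddCommGroup F] [NormedSpace 𝕜 F] [CompleteSpace 𝕜] [CompleteSpace E]
  {u : E →L[𝕜] F}

theorem eventually_isCompl_map (pkg : FredholmPackage u) :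
    ∀ᶠ S in 𝓝 u, IsCompl (pkg.decDom.X₁.map S.toLinearMap) pkg.decCodom.X₀ := by
  have : CompleteSpace pkg.decDom.X₁ := pkg.decDom.isTopCompl.isClosed.completeSpace_coe
  have := pkg.decCodom.finite_X₀
  have : CompleteSpace pkg.decCodom.X₀ := FiniteDimensional.complete 𝕜 _
  -- The map `(m, c) ↦ S m + c` is invertible for `S = u`, and invertibility is an open condition.
  let Φ : (E →L[𝕜] F) → pkg.decDom.X₁ × pkg.decCodom.X₀ →L[𝕜] F := fun S =>
    (S ∘L pkg.decDom.X₁.subtypeL).coprod pkg.decCodom.X₀.subtypeL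
  have hΦ : Continuous Φ :=
    (coprodEquivL 𝕜).continuous.comp
      ((by fun_prop : Continuous fun S : E →L[𝕜] F => S ∘L pkg.decDom.X₁.subtypeL).prodMk
        continuous_const)
  have hu : ∃ e : (pkg.decDom.X₁ × pkg.decCodom.X₀) ≃L[𝕜] F, (e : _ →L[𝕜] F) = Φ u := by
    refine ⟨(pkg.equiv.prodCongr (.refl 𝕜 _)).trans
      (Submodule.prodEquivOfIsTopCompl _ _ pkg.decCodom.isTopCompl), ?_⟩
    ext x
    · have hx : (pkg.equiv x : F) = u x :=
        congrArg Subtype.val (DFunLike.congr_fun pkg.equiv_eq_restrict x)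
      simp [Φ, hx]
    · simp [Φ]
  obtain ⟨e, he⟩ := hu
  filter_upwards [hΦ.continuousAt.eventually_mem (he ▸ e.nhds)] with S ⟨e', he'⟩
  have hS : ∀ m c, e' (m, c) = S m + c := fun m c => by
    have := DFunLike.congr_fun he' (m, c)
    simpa [Φ] using this
  refine ⟨Submodule.disjoint_def.2 ?_, Submodule.codisjoint_iff_exists_add_eq.2 fun y => ?_⟩
  · rintro _ ⟨x, hx, rfl⟩ hSx
    have : e' (⟨x, hx⟩, 0) = e' (0, ⟨S x, hSx⟩) := by simp [hS]
    have := congrArg Prod.snd (e'.injective this)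
    exact (congrArg Subtype.val this).symm
  · obtain ⟨⟨m, c⟩, rfl⟩ := e'.surjective y
    exact ⟨S m, c, ⟨m, m.2, rfl⟩, c.2, (hS m c).symm⟩

theorem finrank_ker_eq_finrank_coker (hu : u.IsFredholm)
    (h : u ∈ closure (Set.range ((↑) : (E ≃L[𝕜] F) → E →L[𝕜] F))) :
    Module.finrank 𝕜 u.ker = Module.finrank 𝕜 (F ⧸ u.range) := by
  obtain ⟨pkg⟩ := hu.nonempty_fredholmPackage
  obtain ⟨_, ⟨e, rfl⟩, he⟩ :=
    ((mem_closure_iff_frequently.1 h).and_eventually (eventually_isCompl_map pkg)).exists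
  rw [pkg.ker_eq, pkg.range_eq]
  calc Module.finrank 𝕜 pkg.decDom.X₀
      = Module.finrank 𝕜 (E ⧸ pkg.decDom.X₁) :=
        (Submodule.quotientEquivOfIsCompl _ _ pkg.decDom.isTopCompl.isCompl).finrank_eq.symm
    _ = Module.finrank 𝕜 (F ⧸ pkg.decDom.X₁.map (e : E →ₗ[𝕜] F)) :=
        (Submodule.Quotient.equiv _ _ e.toLinearEquiv rfl).finrank_eq
    _ = Module.finrank 𝕜 pkg.decCodom.X₀ :=
        (Submodule.quotientEquivOfIsCompl _ _ he).finrank_eq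
    _ = Module.finrank 𝕜 (F ⧸ pkg.decCodom.X₁) :=
        (Submodule.quotientEquivOfIsCompl _ _ pkg.decCodom.isTopCompl.isCompl).finrank_eq.symm

theorem ker_eq_bot_of_mem_closure (hu : u.IsFredholm) (hsurj : u.range = ⊤)
    (h : u ∈ closure {S : E →L[𝕜] F | Function.Injective S}) : u.ker = ⊥ := by
  obtain ⟨pkg⟩ := hu.nonempty_fredholmPackage
  obtain ⟨S, hS, hcompl⟩ :=
    ((mem_closure_iff_frequently.1 h).and_eventually (eventually_isCompl_map pkg)).exists
  have hmap : pkg.decDom.X₁.map S.toLinearMap = ⊤ := by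
    have hbot : pkg.decCodom.X₀ = ⊥ := by
      have := pkg.decCodom.isTopCompl.isCompl.disjoint
      rwa [← pkg.range_eq, hsurj, top_disjoint] at this
    exact codisjoint_bot.1 (hbot ▸ hcompl.codisjoint)
  have hX₁ : pkg.decDom.X₁ = ⊤ := by
    rw [← Submodule.comap_map_eq_of_injective (f := S.toLinearMap) hS pkg.decDom.X₁, hmap,
      Submodule.comap_top]
  have := pkg.decDom.isTopCompl.isCompl.disjoint
  rwa [hX₁, top_disjoint, ← pkg.ker_eq] at this

end Index

section AscentDescent

open Module

variable {R M : Type*} [Ring R] [AddCommGroup M] [Module R M] {f : End R M} {n : ℕ}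

theorem exists_ker_inf_range_pow_le_iInf (f : End R M) [IsArtinian R f.ker] :
    ∃ n : ℕ, f.ker ⊓ (f ^ n).range ≤ ⨅ m : ℕ, (f ^ m).range := by
  let E : ℕ →o (Submodule R f.ker)ᵒᵈ :=
    ⟨fun n => .toDual ((f ^ n).range.comap f.ker.subtype), fun _ _ hmn =>
      Submodule.comap_mono (f.iterateRange.monotone hmn)⟩
  obtain ⟨n, hn⟩ := IsArtinian.monotone_stabilizes E
  refine ⟨n, le_iInf fun m x ⟨hx, hxn⟩ => ?_⟩
  rcases le_total n m with hnm | hmn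
  · exact (hn m hnm ▸ hxn : (⟨x, hx⟩ : f.ker) ∈ (E m).ofDual)
  · exact f.iterateRange.monotone hmn hxn

theorem map_iInf_range_pow (h : f.ker ⊓ (f ^ n).range ≤ ⨅ m : ℕ, (f ^ m).range) :
    (⨅ m : ℕ, (f ^ m).range).map f = ⨅ m : ℕ, (f ^ m).range := by
  have hpow : ∀ m, (f ^ (m + 1)).range = (f ^ m).range.map f := fun m => by
    rw [pow_succ', End.mul_eq_comp, LinearMap.range_comp]
  refine le_antisymm (le_iInf fun m => ?_) fun y hy => ?_
  · exact (Submodule.map_mono (iInf_le _ m)).trans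
      ((hpow m).ge.trans (f.iterateRange.monotone m.le_succ))
  · have hpre : ∀ m, ∃ x ∈ (f ^ m).range, f x = y := fun m =>
      (hpow m).le ((Submodule.mem_iInf _).1 hy (m + 1))
    obtain ⟨x, hx, rfl⟩ := hpre n
    refine ⟨x, (Submodule.mem_iInf _).2 fun m => ?_, rfl⟩
    obtain ⟨x', hx', hxx'⟩ := hpre (max n m)
    have hsub : x - x' ∈ f.ker ⊓ (f ^ n).range :=
      ⟨by simp [hxx'], sub_mem hx (f.iterateRange.monotone (le_max_left n m) hx')⟩
    simpa using add_mem ((Submodule.mem_iInf _).1 (h hsub) m)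
      (f.iterateRange.monotone (le_max_right n m) hx')

theorem ker_pow_succ_eq_of_disjoint (h : Disjoint f.ker (f ^ n).range) :
    (f ^ n).ker = (f ^ (n + 1)).ker := by
  rw [pow_succ', End.mul_eq_comp]
  refine le_antisymm (LinearMap.ker_le_ker_comp _ _) fun x hx => ?_
  exact Submodule.disjoint_def.1 h _ hx ⟨x, rfl⟩

theorem eq_of_le_of_finrank_quotient_eq {K V : Type*} [DivisionRing K] [AddCommGroup V] [Module K V]
    {p q : Submodule K V} [FiniteDimensional K (V ⧸ p)] (hpq : p ≤ q)
    (h : finrank K (V ⧸ p) = finrank K (V ⧸ q)) : p = q := by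
  have : FiniteDimensional K (V ⧸ q) :=
    Module.Finite.of_surjective _ (Submodule.factor_surjective hpq)
  have hinj : Function.Injective (Submodule.factor hpq) :=
    (LinearMap.injective_iff_surjective_of_finrank_eq_finrank h).2 (Submodule.factor_surjective hpq)
  refine le_antisymm hpq fun x hx => ?_
  rw [← Submodule.Quotient.mk_eq_zero] at hx ⊢
  exact hinj (by simpa using hx)

end AscentDescent

section IndexZero

variable {𝕜 X : Type*} [RCLike 𝕜] [NormedAddCommGroup X] [NormedSpace 𝕜 X] {T : X →L[𝕜] X}

theorem isClosed_iInf_range_pow (hT : T.IsFredholm) :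
    IsClosed ((⨅ m : ℕ, (T.toLinearMap ^ m).range : Submodule 𝕜 X) : Set X) := by
  rw [Submodule.coe_iInf]
  exact isClosed_iInter fun m => by
    simpa only [ContinuousLinearMap.toLinearMap_pow] using (isFredholm_pow hT m).isClosed_range

variable [CompleteSpace X]

theorem disjoint_ker_of_map_eq [FiniteDimensional 𝕜 T.ker]
    (h : (0 : 𝕜) ∈ closure {μ | Function.Injective (T - μ • 1 : X →L[𝕜] X)}) {Y : Submodule 𝕜 X}
    (hY : IsClosed (Y : Set X)) (hmap : Y.map T.toLinearMap = Y) : Disjoint T.ker Y := by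
  have : CompleteSpace Y := hY.completeSpace_coe
  let S : Y →L[𝕜] Y := T.restrict fun y hy => hmap.le ⟨y, hy, rfl⟩
  have hsurj : S.range = ⊤ := LinearMap.range_eq_top.2 fun ⟨y, hy⟩ =>
    let ⟨x, hx, hxy⟩ := hmap.ge hy
    ⟨⟨x, hx⟩, Subtype.ext hxy⟩
  have hker : S.ker = T.ker.comap Y.subtype := by
    ext y
    exact Subtype.ext_iff
  have hfred : S.IsFredholm := by
    refine isFredholm_of_isClosed_range (hsurj ▸ isClosed_univ) ?_ ?_
    · rw [hker]
      exact FiniteDimensional.of_injective (Y.subtype.submoduleComap T.ker) fun y y' hyy' =>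
        Subtype.ext (Subtype.ext (congrArg (fun k : T.ker => (k : X)) hyy'))
    · rw [hsurj]
      infer_instance
  have hclosure : S ∈ closure {U : Y →L[𝕜] Y | Function.Injective U} := by
    have hcont : Continuous fun μ : 𝕜 => (S - μ • 1 : Y →L[𝕜] Y) := by fun_prop
    have hzero : S - (0 : 𝕜) • (1 : Y →L[𝕜] Y) = S := by ext; simp
    have := map_mem_closure hcont h (t := {U : Y →L[𝕜] Y | Function.Injective U})
      fun μ hμ y y' hyy' => Subtype.ext (hμ (congrArg Subtype.val hyy'))
    exact hzero ▸ this
  have hbot := ker_eq_bot_of_mem_closure hfred hsurj hclosure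
  rwa [hker, ← Submodule.disjoint_iff_comap_eq_bot, disjoint_comm] at hbot

theorem exists_ker_pow_eq_ker_pow_succ (hT : T.IsFredholm)
    (h : (0 : 𝕜) ∈ closure {μ | Function.Injective (T - μ • 1 : X →L[𝕜] X)}) :
    ∃ n : ℕ, (T ^ n).ker = (T ^ (n + 1)).ker := by
  have := hT.finite_ker
  obtain ⟨n, hn⟩ := exists_ker_inf_range_pow_le_iInf T.toLinearMap
  have hdisj := disjoint_ker_of_map_eq h (isClosed_iInf_range_pow hT) (map_iInf_range_pow hn)
  refine ⟨n, ?_⟩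
  have hker := ker_pow_succ_eq_of_disjoint
    (disjoint_iff_inf_le.2 ((le_inf inf_le_left hn).trans hdisj.le_bot))
  simpa only [ContinuousLinearMap.toLinearMap_pow] using hker

theorem finrank_ker_eq_finrank_coker_of_mem_closure_isUnit (hT : T.IsFredholm)
    (h : T ∈ closure {U | IsUnit U}) :
    Module.finrank 𝕜 T.ker = Module.finrank 𝕜 (X ⧸ T.range) := by
  refine finrank_ker_eq_finrank_coker hT (closure_mono ?_ h)
  rintro _ ⟨e, rfl⟩
  exact ⟨ContinuousLinearEquiv.unitsEquiv 𝕜 X e, rfl⟩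

theorem range_pow_eq_range_pow_succ (hT : T.IsFredholm) (h : T ∈ closure {U | IsUnit U}) {n : ℕ}
    (hn : (T ^ n).ker = (T ^ (n + 1)).ker) : (T ^ n).range = (T ^ (n + 1)).range := by
  have hindex : ∀ m, Module.finrank 𝕜 (T ^ m).ker = Module.finrank 𝕜 (X ⧸ (T ^ m).range) :=
    fun m => finrank_ker_eq_finrank_coker_of_mem_closure_isUnit (isFredholm_pow hT m)
      (map_mem_closure (f := (· ^ m)) (by fun_prop) h fun _ => IsUnit.pow m)
  have := (isFredholm_pow hT (n + 1)).finite_coker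
  have hle : (T ^ (n + 1)).range ≤ (T ^ n).range := by
    rw [pow_succ]
    exact LinearMap.range_comp_le_range _ _
  refine (eq_of_le_of_finrank_quotient_eq hle ?_).symm
  exact (hindex (n + 1)).symm.trans (hn ▸ hindex n)

end IndexZero

section BrowderOfClosure

variable {X : Type*} [NormedAddCommGroup X] [NormedSpace ℂ X] {T : X →L[ℂ] X}

theorem mem_resolventSet_iff {μ : ℂ} : μ ∈ resolventSet ℂ T ↔ IsUnit (T - μ • 1) := by
  rw [spectrum.mem_resolventSet_iff, Algebra.algebraMap_eq_smul_one, IsUnit.sub_iff]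

theorem isBrowder_ofBounded_of_zero_mem_closure [CompleteSpace X] (hT : T.IsFredholm)
    (h : 0 ∈ closure (resolventSet ℂ T)) : IsBrowder (ofBounded T) := by
  have hinj : (0 : ℂ) ∈ closure {μ | Function.Injective (T - μ • 1 : X →L[ℂ] X)} :=
    closure_mono (fun μ hμ =>
      (ContinuousLinearMap.isUnit_iff_bijective.1 (mem_resolventSet_iff.1 hμ)).1) h
  have hunit : T ∈ closure {U | IsUnit U} := by
    have hcont : Continuous fun μ : ℂ => T - μ • 1 := by fun_prop
    simpa using map_mem_closure hcont h fun μ hμ => mem_resolventSet_iff.1 hμ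
  obtain ⟨n, hn⟩ := exists_ker_pow_eq_ker_pow_succ hT hinj
  refine ⟨isFredholm_ofBounded_iff.2 hT, ⟨n, ?_⟩, ⟨n, ?_⟩⟩
  · simpa only [pow_ofBounded, nullSpace_ofBounded] using hn
  · simpa only [pow_ofBounded, range_ofBounded] using range_pow_eq_range_pow_succ hT hunit hn

end BrowderOfClosure

section OuterInverse

variable {R : Type*} [Ring R] {t b m e : R}

theorem isUnit_sub_smul_one_of_isNilpotent {𝕜 A : Type*} [Field 𝕜] [Ring A] [Algebra 𝕜 A] {a : A}
    (ha : IsNilpotent a) {μ : 𝕜} (hμ : μ ≠ 0) : IsUnit (a - μ • 1) := by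
  rw [← Algebra.algebraMap_eq_smul_one, sub_eq_add_neg]
  exact ha.isUnit_add_right_of_commute (hμ.isUnit.map (algebraMap 𝕜 A)).neg
    (Algebra.commute_algebraMap_right μ a).neg_right

/-- `b` is an outer inverse of `t` commuting with `t`. Then `t * b` is an idempotent, and `t` splits
into an invertible part, of inverse `b`, and the residual part `t * (1 - t * b)`; generalized Drazin
inverses of all kinds are the outer inverses of this form with a small residual part. -/
structure IsCommOuterInverse (t b : R) : Prop where
  commute : Commute t b
  mul_mul_self : b * t * b = b

namespace IsCommOuterInverse

theorem isIdempotentElem (h : IsCommOuterInverse t b) : IsIdempotentElem (t * b) := by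
  rw [IsIdempotentElem, ← mul_assoc, mul_assoc t, mul_assoc, h.mul_mul_self]

theorem commute_one_sub (h : IsCommOuterInverse t b) : Commute t (1 - t * b) :=
  (Commute.one_right t).sub_right ((Commute.refl t).mul_right h.commute)

theorem associated_sub (h : IsCommOuterInverse t b) (hm : IsUnit m) (hmt : Commute m t)
    (hmb : Commute m b) (hu : IsUnit (1 - m * b)) :
    Associated (t * (1 - t * b) - m) (t - m) := by
  obtain ⟨m, rfl⟩ := hm
  set q := t * b with hq
  have hqq : q * q = q := h.isIdempotentElem
  have hqb : Commute q b := h.commute.mul_left (.refl b)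
  have hmq : Commute (m : R) q := hmt.mul_right hmb
  set s := ↑m⁻¹ * t
  have hms : m * s = t := m.mul_inv_cancel_left t
  have hmm : Commute (m : R) s := (Commute.refl _).units_inv_right.mul_right hmt
  have hsb : Commute s b := hmb.units_inv_left.mul_left h.commute
  have hsq : Commute s q := hmq.units_inv_left.mul_left ((Commute.refl t).mul_right h.commute)
  have hvanish : (1 - q) * (s * q) = 0 := by
    rw [hsq.eq, ← mul_assoc, sub_mul, one_mul, hqq, sub_self, zero_mul]
  have hmbs : m * b * (s * q) = q := by
    linear_combination (norm := noncomm_ring) hms * b * q - m * hsb.eq * q - hq * q + hqq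
  -- On the range of `q` the residual vanishes, and `1 - m⁻¹ t` turns the remaining `-m` into
  -- `t - m`.
  have hfactor : (t * (1 - q) - m) * (1 - s * q) = t - m := by
    linear_combination (norm := noncomm_ring) hms * q - t * hvanish
  have hmul : (1 - q - m * b) * (1 - s * q) = 1 - m * b := by
    linear_combination (norm := noncomm_ring) hmbs - hvanish
  have hcomm : Commute (1 - q - m * b) (s * q) :=
    (((Commute.one_left s).sub_left hsq.symm).sub_left (hmm.mul_left hsb.symm)).mul_right
      (((Commute.one_left q).sub_left (.refl q)).sub_left (hmq.mul_left hqb.symm))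
  have hunit := (((Commute.one_right _).sub_right hcomm).isUnit_mul_iff.1 (hmul ▸ hu)).2
  exact ⟨hunit.unit, hfactor⟩

theorem associated_sub_smul_one {𝕜 A : Type*} [Field 𝕜] [Ring A] [Algebra 𝕜 A] {t b : A} {μ : 𝕜}
    (h : IsCommOuterInverse t b) (hμ : μ ≠ 0) (hu : IsUnit (1 - μ • b)) :
    Associated (t * (1 - t * b) - μ • 1) (t - μ • 1) := by
  rw [← Algebra.algebraMap_eq_smul_one]
  exact h.associated_sub (hμ.isUnit.map (algebraMap 𝕜 A)) (Algebra.commute_algebraMap_left μ t)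
    (Algebra.commute_algebraMap_left μ b) (by rwa [← Algebra.smul_def])

end IsCommOuterInverse

theorem exists_isCommOuterInverse_of_isUnit {k : ℕ} (he : IsIdempotentElem e) (hc : Commute t e)
    (hu : IsUnit (t ^ (k + 1) + e)) : ∃ b, IsCommOuterInverse t b ∧ t * b = 1 - e := by
  obtain ⟨g, hg⟩ := hu
  have htg : Commute t ↑g⁻¹ :=
    (hg ▸ ((Commute.refl t).pow_right _).add_right hc).units_inv_right
  have hce : Commute t (1 - e) := (Commute.one_right t).sub_right hc
  have htb : t * (↑g⁻¹ * t ^ k * (1 - e)) = 1 - e := by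
    calc t * (↑g⁻¹ * t ^ k * (1 - e)) = ↑g⁻¹ * (t ^ (k + 1) * (1 - e)) := by
          rw [pow_succ', ← mul_assoc, ← mul_assoc, htg.eq]; simp only [mul_assoc]
      _ = ↑g⁻¹ * (g * (1 - e)) := by rw [hg, add_mul, he.mul_one_sub_self, add_zero]
      _ = 1 - e := g.inv_mul_cancel_left _
  have hcomm : Commute t (↑g⁻¹ * t ^ k * (1 - e)) :=
    (htg.mul_right ((Commute.refl t).pow_right k)).mul_right hce
  refine ⟨_, ⟨hcomm, ?_⟩, htb⟩
  rw [mul_assoc, htb, mul_assoc, he.one_sub.eq]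

end OuterInverse

section UnitNearZero

variable {𝕜 A : Type*} [NormedField 𝕜] [NormedRing A] [NormedAlgebra 𝕜 A] [CompleteSpace A]

theorem eventually_isUnit_one_sub_smul (b : A) : ∀ᶠ μ in 𝓝 (0 : 𝕜), IsUnit (1 - μ • b) := by
  have hcont : Continuous fun μ : 𝕜 => 1 - μ • b := by fun_prop
  exact hcont.continuousAt.eventually_mem (Units.isOpen.mem_nhds (by simp))

theorem IsCommOuterInverse.eventually_isUnit_sub_smul_one {t b : A} (h : IsCommOuterInverse t b)
    (hnil : IsNilpotent (t * (1 - t * b))) : ∀ᶠ μ in 𝓝[≠] (0 : 𝕜), IsUnit (t - μ • 1) := by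
  filter_upwards [nhdsWithin_le_nhds (eventually_isUnit_one_sub_smul b), self_mem_nhdsWithin]
    with μ hμu hμ
  exact (h.associated_sub_smul_one hμ hμu).isUnit (isUnit_sub_smul_one_of_isNilpotent hnil hμ)

end UnitNearZero

section Fitting

open Module

theorem isCompl_ker_range_of_mul_self {R M : Type*} [Ring R] [AddCommGroup M] [Module R M]
    {f : End R M} (hker : (f * f).ker = f.ker) (hrange : (f * f).range = f.range) :
    IsCompl f.ker f.range := by
  refine ⟨Submodule.disjoint_def.2 ?_, codisjoint_iff.2 (eq_top_iff.2 fun x _ => ?_)⟩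
  · rintro _ hy ⟨x, rfl⟩
    exact hker.le hy
  · obtain ⟨y, hy⟩ := hrange.ge ⟨x, rfl⟩
    exact Submodule.mem_sup.2 ⟨x - f y, by simp [← hy], f y, ⟨y, rfl⟩, sub_add_cancel x (f y)⟩

theorem range_pow_constant {R M : Type*} [Ring R] [AddCommGroup M] [Module R M] {f : End R M}
    {n : ℕ} (h : (f ^ n).range = (f ^ (n + 1)).range) (m : ℕ) :
    (f ^ n).range = (f ^ (n + m)).range := by
  induction m with
  | zero => rfl
  | succ m ih =>
    rw [h, ← add_assoc, pow_succ', pow_succ', End.mul_eq_comp, End.mul_eq_comp,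
      LinearMap.range_comp, LinearMap.range_comp, ih]

theorem isCompl_ker_pow_range_pow {K V : Type*} [DivisionRing K] [AddCommGroup V] [Module K V]
    {f : End K V} {p q n : ℕ} (hker : (f ^ p).ker = (f ^ (p + 1)).ker)
    (hrange : (f ^ q).range = (f ^ (q + 1)).range) (hp : p ≤ n) (hq : q ≤ n) :
    IsCompl (f ^ n).ker (f ^ n).range := by
  apply isCompl_ker_range_of_mul_self
  · obtain ⟨i, rfl⟩ := Nat.exists_eq_add_of_le hp
    rw [← pow_add, ← End.ker_pow_constant hker i, add_assoc p, ← End.ker_pow_constant hker]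
  · obtain ⟨i, rfl⟩ := Nat.exists_eq_add_of_le hq
    rw [← pow_add, ← range_pow_constant hrange i, add_assoc q, ← range_pow_constant hrange]

end Fitting

section Browder

variable {𝕜 X : Type*} [NontriviallyNormedField 𝕜] [NormedAddCommGroup X] [NormedSpace 𝕜 X]
  {S T : X →L[𝕜] X}

theorem commute_projectionL_ker_range (h : S.ker.IsTopCompl S.range) (hc : Commute T S) :
    Commute T (S.ker.projectionL S.range h) := by
  have hTS : ∀ x, T (S x) = S (T x) := DFunLike.congr_fun hc.eq
  refine ((ContinuousLinearMap.IsIdempotentElem.commute_iff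
    (Submodule.isIdempotentElem_projectionL h)).2 ⟨?_, ?_⟩).symm
  · rw [Submodule.range_projectionL]
    exact fun x hx => (hTS x).symm.trans ((congrArg T hx).trans (map_zero T))
  · rw [Submodule.ker_projectionL]
    rintro _ ⟨x, rfl⟩
    exact ⟨T x, (hTS x).symm⟩

theorem isUnit_add_projectionL_ker_range [CompleteSpace X] (h : S.ker.IsTopCompl S.range) :
    IsUnit (S + S.ker.projectionL S.range h) := by
  set F := S.ker.projectionL S.range h
  rw [ContinuousLinearMap.isUnit_iff_bijective]
  refine ⟨(injective_iff_map_eq_zero _).2 fun x hx => ?_, fun y => ?_⟩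
  · have hSx : S x = - F x := eq_neg_of_add_eq_zero_left hx
    have hFx : F x = 0 := (Submodule.disjoint_def.1 h.isCompl.disjoint) (F x)
      (Submodule.projectionL_apply_mem h x) ⟨-x, by simp [hSx]⟩
    have hx : x ∈ S.ker := by simpa [hFx] using hSx
    rw [← (Submodule.projectionL_eq_self_iff h x).2 hx]
    exact hFx
  · obtain ⟨k, hk, _, ⟨w, rfl⟩, rfl⟩ := Submodule.mem_sup.1
      (h.isCompl.sup_eq_top ▸ Submodule.mem_top : y ∈ S.ker ⊔ S.range)
    obtain ⟨l, hl, _, ⟨z, rfl⟩, rfl⟩ := Submodule.mem_sup.1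
      (h.isCompl.sup_eq_top ▸ Submodule.mem_top : w ∈ S.ker ⊔ S.range)
    refine ⟨k + S z, ?_⟩
    have hFk : F k = k := (Submodule.projectionL_eq_self_iff h k).2 hk
    have hFz : F (S z) = 0 := (Submodule.projectionL_apply_eq_zero_iff h).2 ⟨z, rfl⟩
    simp [show S k = 0 from hk, show S l = 0 from hl, hFk, hFz, add_comm]

end Browder

section BrowderDrazin

variable {X : Type*} [NormedAddCommGroup X] [NormedSpace ℂ X] [CompleteSpace X] {T : X →L[ℂ] X}

theorem exists_isCommOuterInverse_of_isBrowder (hT : IsBrowder (ofBounded T)) :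
    ∃ B, IsCommOuterInverse T B ∧ FiniteDimensional ℂ (1 - T * B).range ∧
      IsNilpotent (T * (1 - T * B)) := by
  obtain ⟨hfred, ⟨p, hp⟩, ⟨q, hq⟩⟩ := hT
  simp only [pow_ofBounded, nullSpace_ofBounded, range_ofBounded,
    ContinuousLinearMap.toLinearMap_pow] at hp hq
  set k := max p q
  have hpow := isFredholm_pow (isFredholm_ofBounded_iff.1 hfred) (k + 1)
  have := hpow.finite_ker
  have hcompl : IsCompl (T ^ (k + 1)).ker (T ^ (k + 1)).range := by
    rw [ContinuousLinearMap.toLinearMap_pow]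
    exact isCompl_ker_pow_range_pow hp hq (by omega) (by omega)
  have htop := (Submodule.IsCompl.isTopCompl_of_isClosed_of_finiteDimensional hcompl.symm
    hpow.isClosed_range).symm
  obtain ⟨B, hB, hTB⟩ := exists_isCommOuterInverse_of_isUnit
    (Submodule.isIdempotentElem_projectionL htop)
    (commute_projectionL_ker_range htop ((Commute.refl T).pow_right (k + 1)))
    (isUnit_add_projectionL_ker_range htop)
  have hF : 1 - T * B = (T ^ (k + 1)).ker.projectionL (T ^ (k + 1)).range htop := by
    rw [hTB, sub_sub_cancel]
  refine ⟨B, hB, ?_, k + 1, ?_⟩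
  · rw [hF, Submodule.range_projectionL]
    exact hpow.finite_ker
  · rw [hB.commute_one_sub.mul_pow,
      hB.isIdempotentElem.one_sub.pow_succ_eq, hF]
    ext x
    exact Submodule.projectionL_apply_mem htop x

end BrowderDrazin

section SpectralBound

variable {𝕜 A : Type*} [NormedField 𝕜] [NormedRing A] [NormedAlgebra 𝕜 A] {a : A}

theorem spectrum_subset_closedBall_of_norm_pow_le [CompleteSpace A] {C q : ℝ} (hq : 0 ≤ q)
    (h : ∀ n : ℕ, ‖a ^ (n + 1)‖ ≤ C * q ^ (n + 1)) :
    spectrum 𝕜 a ⊆ Metric.closedBall 0 q := by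
  intro μ hμ
  rw [mem_closedBall_zero_iff]
  by_contra! hlt
  have hμ0 : 0 < ‖μ‖ := hq.trans_lt hlt
  have hbound : ∀ n : ℕ, 1 ≤ C * ‖(1 : A)‖ * (q / ‖μ‖) ^ (n + 1) := fun n => by
    rw [div_pow, ← mul_div_assoc, one_le_div₀ (by positivity)]
    calc ‖μ‖ ^ (n + 1) = ‖μ ^ (n + 1)‖ := (norm_pow _ _).symm
      _ ≤ ‖a ^ (n + 1)‖ * ‖(1 : A)‖ :=
        spectrum.norm_le_norm_mul_of_mem (spectrum.pow_mem_pow a (n + 1) hμ)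
      _ ≤ C * q ^ (n + 1) * ‖(1 : A)‖ := by gcongr; exact h n
      _ = C * ‖(1 : A)‖ * q ^ (n + 1) := by ring
  have hlim : Tendsto (fun n : ℕ => C * ‖(1 : A)‖ * (q / ‖μ‖) ^ (n + 1)) atTop (𝓝 0) := by
    simpa using (((tendsto_pow_atTop_nhds_zero_of_lt_one (by positivity)
      ((div_lt_one hμ0).2 hlt)).comp (tendsto_add_atTop_nat 1)).const_mul (C * ‖(1 : A)‖))
  exact zero_lt_one.not_ge (ge_of_tendsto' hlim hbound)

theorem isUnit_one_sub_smul_of_spectrum_subset_closedBall {s : ℝ} {μ : 𝕜}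
    (h : spectrum 𝕜 a ⊆ Metric.closedBall 0 s⁻¹) (hμs : ‖μ‖ < s) : IsUnit (1 - μ • a) := by
  rcases eq_or_ne μ 0 with rfl | hμ
  · simp
  have hmem : μ⁻¹ ∉ spectrum 𝕜 a := fun hspec => by
    have hle := mem_closedBall_zero_iff.1 (h hspec)
    rw [norm_inv, inv_le_inv₀ (norm_pos_iff.2 hμ) ((norm_nonneg μ).trans_lt hμs)] at hle
    exact hle.not_gt hμs
  have hunit := (hμ.isUnit.map (algebraMap 𝕜 A)).mul (spectrum.notMem_iff.1 hmem)
  rwa [mul_sub, ← map_mul, mul_inv_cancel₀ hμ, map_one, ← Algebra.smul_def] at hunit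

end SpectralBound

section Resolvent

variable {R A : Type*} [CommRing R] [Ring A] [Algebra R A] {a : A} {z : R}

theorem mul_resolvent (hz : z ∈ resolventSet R a) :
    a * resolvent a z = z • resolvent a z - 1 := by
  have := Ring.mul_inverse_cancel _ hz
  rw [sub_mul, ← Algebra.smul_def] at this
  rw [resolvent, ← this, sub_sub_cancel]

theorem resolvent_mul (hz : z ∈ resolventSet R a) :
    resolvent a z * a = z • resolvent a z - 1 := by
  have := Ring.inverse_mul_cancel _ hz
  rw [mul_sub, ← Algebra.commutes, ← Algebra.smul_def] at this
  rw [resolvent, ← this, sub_sub_cancel]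

end Resolvent

section LaurentCoeff

theorem circleIntegral_comp_comm {E F : Type*} [NormedAddCommGroup E] [NormedSpace ℂ E]
    [CompleteSpace E] [NormedAddCommGroup F] [NormedSpace ℂ F] [CompleteSpace F] (L : E →L[ℂ] F)
    {f : ℂ → E} {c : ℂ} {R : ℝ} (hf : CircleIntegrable f c R) :
    (∮ z in C(c, R), L (f z)) = L (∮ z in C(c, R), f z) := by
  simp only [circleIntegral, ← L.map_smul]
  exact L.intervalIntegral_comp_comm hf.out

theorem two_pi_I_inv_mul_circleIntegral_zpow {s : ℝ} (hs : s ≠ 0) (k : ℤ) :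
    (2 * Real.pi * Complex.I : ℂ)⁻¹ * ∮ z in C(0, s), z ^ k = if k = -1 then 1 else 0 := by
  split_ifs with hk
  · have hint := circleIntegral.integral_sub_center_inv 0 hs
    simp only [sub_zero] at hint
    simp only [hk, zpow_neg_one, hint, inv_mul_cancel₀ Complex.two_pi_I_ne_zero]
  · have hint := circleIntegral.integral_sub_zpow_of_ne hk 0 0 s
    simp only [sub_zero] at hint
    rw [hint, mul_zero]

variable {A : Type*} [NormedRing A] [NormedAlgebra ℂ A]

/-- The `k`-th moment of the resolvent of `a` over the circle of radius `s` about `0`. When the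
circle lies in the resolvent set this is the coefficient of `z ^ (-(k + 1))` in the Laurent
expansion of the resolvent; its value at `k = 0` is the Riesz projection of the part of the spectrum
inside the circle. -/
noncomputable def laurentCoeff (a : A) (s : ℝ) (k : ℤ) : A :=
  (2 * Real.pi * Complex.I : ℂ)⁻¹ • ∮ z in C(0, s), z ^ k • resolvent a z

variable [CompleteSpace A] {a : A} {s : ℝ}

theorem continuousOn_zpow_smul_resolvent {S : Set ℂ} (hS : S ⊆ resolventSet ℂ a) (h0 : 0 ∉ S)
    (k : ℤ) : ContinuousOn (fun z => z ^ k • resolvent a z) S := fun z hz =>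
  ((continuousAt_zpow₀ z k (.inl (ne_of_mem_of_not_mem hz h0))).smul
    (spectrum.hasDerivAt_resolvent_const_left (hS hz)).continuousAt).continuousWithinAt

theorem circleIntegrable_zpow_smul_resolvent (hs : 0 < s)
    (h : Metric.sphere 0 s ⊆ resolventSet ℂ a) (k : ℤ) :
    CircleIntegrable (fun z => z ^ k • resolvent a z) 0 s :=
  (continuousOn_zpow_smul_resolvent h (by simp [hs.ne]) k).circleIntegrable hs.le

theorem exists_norm_laurentCoeff_le (hs : 0 < s) (h : Metric.sphere 0 s ⊆ resolventSet ℂ a) :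
    ∃ C, 0 ≤ C ∧ ∀ k, ‖laurentCoeff a s k‖ ≤ C * s ^ k := by
  have hcont : ContinuousOn (fun z : ℂ => resolvent a z) (Metric.sphere 0 s) := by
    simpa using continuousOn_zpow_smul_resolvent h (by simp [hs.ne]) 0
  obtain ⟨M, hM⟩ := (isCompact_sphere (0 : ℂ) s).exists_bound_of_continuousOn hcont
  refine ⟨s * max M 0, by positivity, fun k => ?_⟩
  have hbound : ∀ z ∈ Metric.sphere (0 : ℂ) s, ‖z ^ k • resolvent a z‖ ≤ s ^ k * max M 0 :=
    fun z hz => by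
      rw [norm_smul, norm_zpow, mem_sphere_zero_iff_norm.1 hz]
      gcongr
      exact (hM z hz).trans (le_max_left _ _)
  calc ‖laurentCoeff a s k‖ ≤ s * (s ^ k * max M 0) :=
        circleIntegral.norm_two_pi_i_inv_smul_integral_le_of_norm_le_const hs.le hbound
    _ = s * max M 0 * s ^ k := by ring

theorem commute_laurentCoeff (hs : 0 < s) (h : Metric.sphere 0 s ⊆ resolventSet ℂ a) (k : ℤ) :
    Commute a (laurentCoeff a s k) := by
  have hint := circleIntegrable_zpow_smul_resolvent hs h k
  have hleft := circleIntegral_comp_comm (ContinuousLinearMap.mul ℂ A a) hint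
  have hright := circleIntegral_comp_comm ((ContinuousLinearMap.mul ℂ A).flip a) hint
  simp only [ContinuousLinearMap.mul_apply', ContinuousLinearMap.flip_apply] at hleft hright
  rw [commute_iff_eq, laurentCoeff, mul_smul_comm, smul_mul_assoc, ← hleft, ← hright]
  congr 1
  refine circleIntegral.integral_congr hs.le fun z hz => ?_
  simp only [mul_smul_comm, smul_mul_assoc, mul_resolvent (h hz), resolvent_mul (h hz)]

theorem mul_laurentCoeff (hs : 0 < s) (h : Metric.sphere 0 s ⊆ resolventSet ℂ a) (k : ℤ) :
    a * laurentCoeff a s k = laurentCoeff a s (k + 1) - if k = -1 then 1 else 0 := by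
  have hne : ∀ z ∈ Metric.sphere (0 : ℂ) s, z ≠ 0 := by
    rintro _ hz rfl
    simp [hs.ne] at hz
  have hleft := circleIntegral_comp_comm (ContinuousLinearMap.mul ℂ A a)
    (circleIntegrable_zpow_smul_resolvent hs h k)
  simp only [ContinuousLinearMap.mul_apply'] at hleft
  have hconst : CircleIntegrable (fun z : ℂ => z ^ k • (1 : A)) 0 s :=
    ContinuousOn.circleIntegrable hs.le fun z hz =>
      ((continuousAt_zpow₀ z k (.inl (hne z hz))).smul continuousAt_const).continuousWithinAt
  have hdelta : (if k = -1 then 1 else 0 : A) =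
      (2 * Real.pi * Complex.I : ℂ)⁻¹ • ∮ z in C(0, s), z ^ k • (1 : A) := by
    rw [circleIntegral.integral_smul_const, ← mul_smul,
      two_pi_I_inv_mul_circleIntegral_zpow hs.ne', ite_smul, one_smul, zero_smul]
  rw [hdelta, laurentCoeff, laurentCoeff, mul_smul_comm, ← hleft, ← smul_sub,
    ← circleIntegral.integral_sub (circleIntegrable_zpow_smul_resolvent hs h (k + 1)) hconst]
  congr 1
  refine circleIntegral.integral_congr hs.le fun z hz => ?_
  simp only [mul_smul_comm, mul_resolvent (h hz), smul_sub, smul_smul, zpow_add_one₀ (hne z hz)]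

theorem pow_mul_laurentCoeff (hs : 0 < s) (h : Metric.sphere 0 s ⊆ resolventSet ℂ a) {k : ℤ}
    {n : ℕ} (hk : 0 ≤ k ∨ k + n < 0) :
    a ^ n * laurentCoeff a s k = laurentCoeff a s (k + n) := by
  induction n with
  | zero => simp
  | succ n ih =>
    rw [pow_succ', mul_assoc, ih (by omega), mul_laurentCoeff hs h, if_neg (by omega), sub_zero]
    push_cast
    rw [add_assoc]

end LaurentCoeff

section Annulus

variable {A : Type*} [NormedRing A] [NormedAlgebra ℂ A] [CompleteSpace A] {a : A} {r s : ℝ}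

theorem sphere_subset_norm_preimage {E : Type*} [SeminormedAddCommGroup E] {x : ℝ} {S : Set ℝ}
    (hx : x ∈ S) : Metric.sphere (0 : E) x ⊆ norm ⁻¹' S := by
  intro z hz
  rwa [Set.mem_preimage, mem_sphere_zero_iff_norm.1 hz]

theorem laurentCoeff_eq_of_le (hr : 0 < r) (hrs : r ≤ s)
    (h : norm ⁻¹' Set.Icc r s ⊆ resolventSet ℂ a) (k : ℤ) :
    laurentCoeff a s k = laurentCoeff a r k := by
  have hann : Metric.closedBall (0 : ℂ) s \ Metric.ball 0 r = norm ⁻¹' Set.Icc r s := by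
    ext z
    simp [and_comm]
  have hne : (0 : ℂ) ∉ (norm ⁻¹' Set.Icc r s : Set ℂ) := fun h0 => by
    simpa [hr.not_ge] using h0.1
  rw [laurentCoeff, laurentCoeff,
    Complex.circleIntegral_eq_of_differentiable_on_annulus_off_countable hr hrs
      Set.countable_empty (hann ▸ continuousOn_zpow_smul_resolvent h hne k)]
  rintro z ⟨hz, -⟩
  have hz : z ∈ (norm ⁻¹' Set.Icc r s : Set ℂ) :=
    hann ▸ Set.sdiff_subset_sdiff Metric.ball_subset_closedBall Metric.ball_subset_closedBall hz
  exact (differentiableAt_zpow.2 (.inl (ne_of_mem_of_not_mem hz hne))).smul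
    (spectrum.hasDerivAt_resolvent_const_left (h hz)).differentiableAt

theorem exists_norm_laurentCoeff_le_and_le (hr : 0 < r) (hrs : r ≤ s)
    (h : norm ⁻¹' Set.Icc r s ⊆ resolventSet ℂ a) :
    ∃ C, 0 ≤ C ∧ ∀ k, ‖laurentCoeff a r k‖ ≤ C * r ^ k ∧ ‖laurentCoeff a r k‖ ≤ C * s ^ k := by
  have hs : 0 < s := hr.trans_le hrs
  obtain ⟨C, hC, hCr⟩ := exists_norm_laurentCoeff_le hr
    ((sphere_subset_norm_preimage (Set.left_mem_Icc.2 hrs)).trans h)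
  obtain ⟨D, -, hDs⟩ := exists_norm_laurentCoeff_le hs
    ((sphere_subset_norm_preimage (Set.right_mem_Icc.2 hrs)).trans h)
  refine ⟨max C D, le_max_of_le_left hC, fun k => ⟨(hCr k).trans ?_, ?_⟩⟩
  · gcongr
    exact le_max_left _ _
  · rw [← laurentCoeff_eq_of_le hr hrs h]
    refine (hDs k).trans ?_
    gcongr
    exact le_max_right _ _

theorem laurentCoeff_zero_mul_of_neg (hr : 0 < r) (hrs : r < s)
    (h : norm ⁻¹' Set.Icc r s ⊆ resolventSet ℂ a) {k : ℤ} (hk : k < 0) :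
    laurentCoeff a r 0 * laurentCoeff a r k = 0 := by
  have hs : 0 < s := hr.trans hrs
  have hsphere := (sphere_subset_norm_preimage (Set.left_mem_Icc.2 hrs.le)).trans h
  obtain ⟨C, hC, hbound⟩ := exists_norm_laurentCoeff_le_and_le hr hrs.le h
  -- Moving `a ^ n` across the product makes it `O((r / s) ^ n)`: the left factor is estimated on
  -- the circle of radius `r`, the right one on the circle of radius `s`.
  have hshift : ∀ n : ℕ, laurentCoeff a r 0 * laurentCoeff a r k =
      laurentCoeff a r n * laurentCoeff a r (k - n) := fun n => by
    have h0 := pow_mul_laurentCoeff hr hsphere (k := 0) (n := n) (.inl le_rfl)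
    have hkn := pow_mul_laurentCoeff hr hsphere (k := k - n) (n := n) (.inr (by omega))
    rw [zero_add] at h0
    rw [sub_add_cancel] at hkn
    rw [← h0, ← hkn, ← mul_assoc, ((commute_laurentCoeff hr hsphere 0).pow_left n).eq]
  have hle : ∀ n : ℕ, ‖laurentCoeff a r 0 * laurentCoeff a r k‖ ≤ C * C * s ^ k * (r / s) ^ n :=
    fun n => calc
      _ ≤ ‖laurentCoeff a r n‖ * ‖laurentCoeff a r (k - n)‖ := hshift n ▸ norm_mul_le _ _
      _ ≤ (C * r ^ (n : ℤ)) * (C * s ^ (k - n)) := by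
        gcongr
        exacts [(hbound n).1, (hbound _).2]
      _ = C * C * s ^ k * (r / s) ^ n := by
        rw [zpow_sub₀ hs.ne', zpow_natCast, zpow_natCast, div_pow]
        ring
  have hlim : Tendsto (fun n : ℕ => C * C * s ^ k * (r / s) ^ n) atTop (𝓝 0) := by
    simpa using (tendsto_pow_atTop_nhds_zero_of_lt_one (by positivity)
      ((div_lt_one hs).2 hrs)).const_mul (C * C * s ^ k)
  exact norm_le_zero_iff.1 (ge_of_tendsto' hlim hle)

theorem laurentCoeff_neg_one_mul_of_neg (hr : 0 < r) (hrs : r < s)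
    (h : norm ⁻¹' Set.Icc r s ⊆ resolventSet ℂ a) {k : ℤ} (hk : k < 0) :
    laurentCoeff a r (-1) * laurentCoeff a r k = -laurentCoeff a r (k - 1) := by
  have hsphere := (sphere_subset_norm_preimage (Set.left_mem_Icc.2 hrs.le)).trans h
  have hzero := laurentCoeff_zero_mul_of_neg hr hrs h (show k - 1 < 0 by omega)
  have hone := mul_laurentCoeff hr hsphere (-1)
  have hk := mul_laurentCoeff hr hsphere (k - 1)
  rw [if_neg (by omega), sub_add_cancel, sub_zero] at hk
  rw [if_pos rfl, neg_add_cancel] at hone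
  rw [← hk, ← mul_assoc, ← (commute_laurentCoeff hr hsphere (-1)).eq, hone, sub_mul, hzero,
    one_mul, zero_sub]

theorem neg_laurentCoeff_neg_one_pow (hr : 0 < r) (hrs : r < s)
    (h : norm ⁻¹' Set.Icc r s ⊆ resolventSet ℂ a) (n : ℕ) :
    (-laurentCoeff a r (-1)) ^ (n + 1) = -laurentCoeff a r (-(n + 1)) := by
  induction n with
  | zero => simp
  | succ n ih =>
    rw [pow_succ', ih, neg_mul_neg, laurentCoeff_neg_one_mul_of_neg hr hrs h (by omega)]
    push_cast
    ring_nf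

theorem exists_isCommOuterInverse_of_annulus (hr : 0 < r) (hrs : r < s)
    (h : norm ⁻¹' Set.Icc r s ⊆ resolventSet ℂ a) :
    ∃ b, IsCommOuterInverse a b ∧ spectrum ℂ (a * (1 - a * b)) ⊆ Metric.closedBall 0 r ∧
      spectrum ℂ b ⊆ Metric.closedBall 0 s⁻¹ := by
  have hs : 0 < s := hr.trans hrs
  have hsphere := (sphere_subset_norm_preimage (Set.left_mem_Icc.2 hrs.le)).trans h
  obtain ⟨C, -, hbound⟩ := exists_norm_laurentCoeff_le_and_le hr hrs.le h
  set c := laurentCoeff a r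
  have hcomm : ∀ k, Commute a (c k) := commute_laurentCoeff hr hsphere
  have hmul : a * c (-1) = c 0 - 1 := by simpa using mul_laurentCoeff hr hsphere (-1)
  have hproj : a * -c (-1) = 1 - c 0 := by rw [mul_neg, hmul, neg_sub]
  have hb : IsCommOuterInverse a (-c (-1)) := by
    refine ⟨(hcomm (-1)).neg_right, ?_⟩
    rw [← (hcomm (-1)).neg_right.eq, hproj, sub_mul, one_mul, mul_neg,
      laurentCoeff_zero_mul_of_neg hr hrs h (by decide), neg_zero, sub_zero]
  have hidem : IsIdempotentElem (c 0) := by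
    simpa [hproj] using hb.isIdempotentElem.one_sub
  refine ⟨-c (-1), hb, spectrum_subset_closedBall_of_norm_pow_le (C := C) hr.le fun n => ?_,
    spectrum_subset_closedBall_of_norm_pow_le (C := C) (inv_nonneg.2 hs.le) fun n => ?_⟩
  · have hres : (a * c 0) ^ (n + 1) = c (n + 1) := by
      rw [(hcomm 0).mul_pow, hidem.pow_succ_eq, pow_mul_laurentCoeff hr hsphere (.inl le_rfl)]
      simp [c]
    rw [hproj, sub_sub_cancel, hres]
    exact_mod_cast (hbound (n + 1)).1
  · rw [neg_laurentCoeff_neg_one_pow hr hrs h, norm_neg]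
    refine (hbound _).2.trans_eq ?_
    rw [← zpow_natCast, inv_zpow', Nat.cast_succ]

end Annulus

section BrowderSpectrum

variable {X : Type*} [NormedAddCommGroup X] [NormedSpace ℂ X] {T : X →L[ℂ] X}

theorem sub_mem_resolventSet_sub_smul_one {μ ν : ℂ} :
    ν - μ ∈ resolventSet ℂ (T - μ • 1) ↔ ν ∈ resolventSet ℂ T := by
  rw [mem_resolventSet_iff, mem_resolventSet_iff, sub_smul, sub_sub_sub_cancel_right]

variable [CompleteSpace X]

theorem isBrowder_of_mem_closure_resolventSet {μ : ℂ} (hT : (T - μ • 1).IsFredholm)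
    (h : μ ∈ closure (resolventSet ℂ T)) : IsBrowder (ofBounded (T - μ • 1)) := by
  have hcont : Continuous fun ν : ℂ => ν - μ := by fun_prop
  have hzero := map_mem_closure hcont h fun ν => sub_mem_resolventSet_sub_smul_one.2
  rw [sub_self] at hzero
  exact isBrowder_ofBounded_of_zero_mem_closure hT hzero

theorem eventually_mem_resolventSet_of_isBrowder {μ : ℂ}
    (hT : IsBrowder (ofBounded (T - μ • 1))) : ∀ᶠ ν in 𝓝[≠] μ, ν ∈ resolventSet ℂ T := by
  obtain ⟨B, hB, -, hnil⟩ := exists_isCommOuterInverse_of_isBrowder hT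
  have hshift : Tendsto (fun ν : ℂ => ν - μ) (𝓝[≠] μ) (𝓝[≠] 0) := by
    have hcont : Continuous fun ν : ℂ => ν - μ := by fun_prop
    refine tendsto_nhdsWithin_iff.2 ⟨(hcont.tendsto' μ 0 (sub_self μ)).mono_left nhdsWithin_le_nhds,
      ?_⟩
    filter_upwards [self_mem_nhdsWithin] with ν hν using sub_ne_zero.2 hν
  filter_upwards [hshift.eventually (hB.eventually_isUnit_sub_smul_one hnil)] with ν hν
  exact sub_mem_resolventSet_sub_smul_one.1 (mem_resolventSet_iff.2 hν)

theorem mem_closure_resolventSet_of_isBrowder {μ : ℂ} (hT : IsBrowder (ofBounded (T - μ • 1))) :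
    μ ∈ closure (resolventSet ℂ T) :=
  mem_closure_iff_frequently.2
    ((eventually_mem_resolventSet_of_isBrowder hT).frequently.filter_mono nhdsWithin_le_nhds)

theorem subset_closure_resolventSet_of_isPreconnected {Ω : Set ℂ} (hΩ : IsPreconnected Ω)
    (hfred : ∀ μ ∈ Ω, (T - μ • 1).IsFredholm) (hne : (Ω ∩ resolventSet ℂ T).Nonempty) :
    Ω ⊆ closure (resolventSet ℂ T) := by
  set ρ := resolventSet ℂ T
  have hclosed : closure (interior (closure ρ)) ∩ Ω ⊆ interior (closure ρ) := by
    rintro μ ⟨hμ, hμΩ⟩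
    have hμρ : μ ∈ closure ρ := closure_minimal interior_subset isClosed_closure hμ
    have hev := eventually_nhdsWithin_iff.1 (eventually_mem_resolventSet_of_isBrowder
      (isBrowder_of_mem_closure_resolventSet (hfred μ hμΩ) hμρ))
    rw [mem_interior_iff_mem_nhds]
    filter_upwards [hev] with ν hν
    rcases eq_or_ne ν μ with rfl | hνμ
    exacts [hμρ, subset_closure (hν hνμ)]
  have hmeet : (Ω ∩ interior (closure ρ)).Nonempty :=
    hne.mono (Set.inter_subset_inter_right Ω
      (spectrum.isOpen_resolventSet T).subset_interior_closure)
  exact (hΩ.subset_of_closure_inter_subset isOpen_interior hmeet hclosed).trans interior_subset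

end BrowderSpectrum

section Riesz

variable {X : Type*} [NormedAddCommGroup X] [NormedSpace ℂ X] {T B : X →L[ℂ] X}

theorem not_accPt_browderSpectrum_ofBounded_iff :
    ¬ AccPt (0 : ℂ) (𝓟 (browderSpectrum (ofBounded T))) ↔
      ∀ᶠ μ in 𝓝[≠] (0 : ℂ), IsBrowder (ofBounded (T - μ • 1)) := by
  rw [accPt_iff_frequently_nhdsNE, not_frequently]
  simp only [browderSpectrum, Set.mem_ofPred_eq, not_not, subScalar_ofBounded]

theorem isGeneralizedDrazinRieszInvertible_ofBounded_iff_exists :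
    IsGeneralizedDrazinRieszInvertible (ofBounded T) ↔
      ∃ B, IsCommOuterInverse T B ∧ IsRiesz (T * (1 - T * B)) := by
  constructor
  · rintro ⟨B, hB, hAB, hBAB, hcomm, N, hN, hRiesz⟩
    have hresidual : N = T * (1 - T * B) := ContinuousLinearMap.ext hN
    exact ⟨B, ⟨ContinuousLinearMap.ext fun x => (hcomm ⟨x, trivial⟩).symm,
      ContinuousLinearMap.ext hBAB⟩, hresidual ▸ hRiesz⟩
  · rintro ⟨B, hB, hRiesz⟩
    exact ⟨B, fun _ => trivial, fun _ => trivial, DFunLike.congr_fun hB.mul_mul_self,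
      fun x => (DFunLike.congr_fun hB.commute.eq (x : X)).symm, _, fun _ => rfl, hRiesz⟩

theorem isFredholm_iff_of_associated {S U : X →L[ℂ] X} (h : Associated S U) :
    S.IsFredholm ↔ U.IsFredholm := by
  suffices ∀ {S U : X →L[ℂ] X}, Associated S U → S.IsFredholm → U.IsFredholm from
    ⟨this h, this h.symm⟩
  rintro S _ ⟨W, rfl⟩ hS
  exact isFredholm_comp hS (isFredholm_of_isUnit W.isUnit)

variable [CompleteSpace X]

theorem isRiesz_iff :
    IsRiesz T ↔ ¬ T.IsFredholm ∧ ∀ μ : ℂ, μ ≠ 0 → (T - μ • 1).IsFredholm := by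
  have hmem : ∀ μ, μ ∈ essentialSpectrum (ofBounded T) ↔ ¬ (T - μ • 1).IsFredholm := fun μ => by
    rw [essentialSpectrum, Set.mem_ofPred_eq, subScalar_ofBounded, isFredholm_ofBounded_iff]
  have hzero : 0 ∈ essentialSpectrum (ofBounded T) ↔ ¬ T.IsFredholm := by simp [hmem]
  rw [← hzero]
  change essentialSpectrum (ofBounded T) = {0} ↔ _
  rw [Set.eq_singleton_iff_unique_mem]
  refine and_congr_right fun _ => forall_congr' fun μ => ?_
  rw [hmem, not_imp_comm]

theorem compl_zero_subset_closure_resolventSet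
    (hT : ∀ μ : ℂ, μ ≠ 0 → (T - μ • 1).IsFredholm) : {0}ᶜ ⊆ closure (resolventSet ℂ T) := by
  refine subset_closure_resolventSet_of_isPreconnected
    (isConnected_compl_singleton_of_one_lt_rank (by simp) 0).isPreconnected hT ?_
  obtain ⟨μ, hμ⟩ := NormedField.exists_lt_norm ℂ (‖T‖ * ‖(1 : X →L[ℂ] X)‖)
  exact ⟨μ, norm_pos_iff.1 (lt_of_le_of_lt (by positivity) hμ),
    spectrum.mem_resolventSet_of_norm_lt_mul hμ⟩

theorem eventually_isBrowder_of_isRiesz (hB : IsCommOuterInverse T B)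
    (hRiesz : IsRiesz (T * (1 - T * B))) :
    ∀ᶠ μ in 𝓝[≠] (0 : ℂ), IsBrowder (ofBounded (T - μ • 1)) := by
  have hfred := (isRiesz_iff.1 hRiesz).2
  filter_upwards [nhdsWithin_le_nhds (eventually_isUnit_one_sub_smul B).eventually_nhds,
    self_mem_nhdsWithin] with μ hμ hμ0
  refine isBrowder_of_mem_closure_resolventSet ((isFredholm_iff_of_associated
    (hB.associated_sub_smul_one hμ0 hμ.self_of_nhds)).1 (hfred μ hμ0)) ?_
  have hfreq := mem_closure_iff_frequently.1 (compl_zero_subset_closure_resolventSet hfred hμ0)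
  refine mem_closure_iff_frequently.2
    ((hfreq.and_eventually (hμ.and (isOpen_ne.mem_nhds hμ0))).mono ?_)
  rintro ν ⟨hν, hνu, hν0⟩
  rw [mem_resolventSet_iff] at hν ⊢
  exact (hB.associated_sub_smul_one hν0 hνu).isUnit hν

theorem exists_isRiesz_of_isBrowder (hX : ¬ FiniteDimensional ℂ X)
    (hT : IsBrowder (ofBounded T)) :
    ∃ B, IsCommOuterInverse T B ∧ IsRiesz (T * (1 - T * B)) := by
  obtain ⟨B, hB, hfin, hnil⟩ := exists_isCommOuterInverse_of_isBrowder hT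
  have : FiniteDimensional ℂ (T * (1 - T * B)).range := by
    rw [hB.commute_one_sub.eq]
    exact Submodule.finiteDimensional_of_le (LinearMap.range_comp_le_range _ _)
  exact ⟨B, hB, isRiesz_iff.2 ⟨not_isFredholm_of_finiteDimensional_range hX, fun μ hμ =>
    isFredholm_of_isUnit (isUnit_sub_smul_one_of_isNilpotent hnil hμ)⟩⟩

end Riesz

section Isolated

variable {X : Type*} [NormedAddCommGroup X] [NormedSpace ℂ X] [CompleteSpace X] {T : X →L[ℂ] X}

theorem finite_inter_spectrum_of_isBrowder {K : Set ℂ} (hK : IsClosed K)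
    (h : ∀ μ ∈ K, IsBrowder (ofBounded (T - μ • 1))) : (K ∩ spectrum ℂ T).Finite := by
  by_contra hinf
  obtain ⟨μ, hμ, hacc⟩ := Set.Infinite.exists_accPt_of_subset_isCompact hinf
    ((spectrum.isCompact T).inter_left hK) subset_rfl
  obtain ⟨ν, hν, hνρ⟩ := ((accPt_iff_frequently_nhdsNE.1 hacc).and_eventually
    (eventually_mem_resolventSet_of_isBrowder (h μ hμ.1))).exists
  exact hν.2 hνρ

theorem exists_Icc_subset_of_finite {F : Set ℝ} (hF : F.Finite) {a b : ℝ} (hab : a < b) :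
    ∃ r s, r < s ∧ Set.Icc r s ⊆ Set.Ioo a b \ F := by
  obtain ⟨c, hc, hcF⟩ := (Set.Ioo_infinite hab).exists_notMem_finite hF
  obtain ⟨δ, hδ, hball⟩ := Metric.nhds_basis_closedBall.mem_iff.1
    ((isOpen_Ioo.sdiff hF.isClosed).mem_nhds ⟨hc, hcF⟩)
  exact ⟨c - δ, c + δ, by linarith, Real.closedBall_eq_Icc ▸ hball⟩

theorem exists_annulus_subset_resolventSet {ε : ℝ} (hε : 0 < ε)
    (h : ∀ μ : ℂ, μ ≠ 0 → ‖μ‖ < ε → IsBrowder (ofBounded (T - μ • 1))) :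
    ∃ r s : ℝ, 0 < r ∧ r < s ∧ s < ε ∧ norm ⁻¹' Set.Icc r s ⊆ resolventSet ℂ T := by
  set K : Set ℂ := norm ⁻¹' Set.Icc (ε / 3) (ε / 2)
  have hK : ∀ μ ∈ K, IsBrowder (ofBounded (T - μ • 1)) := fun μ hμ =>
    h μ (norm_pos_iff.1 (by linarith [hμ.1])) (by linarith [hμ.2])
  have hfin := finite_inter_spectrum_of_isBrowder (isClosed_Icc.preimage continuous_norm) hK
  obtain ⟨r, s, hrs, hsub⟩ := exists_Icc_subset_of_finite (hfin.image norm)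
    (show ε / 3 < ε / 2 by linarith)
  have hr := (hsub (Set.left_mem_Icc.2 hrs.le)).1.1
  have hs := (hsub (Set.right_mem_Icc.2 hrs.le)).1.2
  refine ⟨r, s, by linarith, hrs, by linarith, fun z hz => by_contra fun hspec => ?_⟩
  exact (hsub hz).2 ⟨z, ⟨Set.Ioo_subset_Icc_self (hsub hz).1, hspec⟩, rfl⟩

theorem exists_isRiesz_of_not_isFredholm (hT : ¬ T.IsFredholm) {ε : ℝ} (hε : 0 < ε)
    (h : ∀ μ : ℂ, μ ≠ 0 → ‖μ‖ < ε → IsBrowder (ofBounded (T - μ • 1))) :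
    ∃ B, IsCommOuterInverse T B ∧ IsRiesz (T * (1 - T * B)) := by
  obtain ⟨r, s, hr, hrs, hsε, hann⟩ := exists_annulus_subset_resolventSet hε h
  obtain ⟨B, hB, hres, hBspec⟩ := exists_isCommOuterInverse_of_annulus hr hrs hann
  refine ⟨B, hB, isRiesz_iff.2 ⟨fun hN =>
    hT (isFredholm_of_mul_of_mul hN (hB.commute_one_sub.eq ▸ hN)), fun μ hμ => ?_⟩⟩
  rcases lt_or_ge ‖μ‖ s with hlt | hge
  · have hunit := isUnit_one_sub_smul_of_spectrum_subset_closedBall hBspec hlt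
    exact (isFredholm_iff_of_associated (hB.associated_sub_smul_one hμ hunit)).2
      (isFredholm_ofBounded_iff.1 (h μ hμ (hlt.trans hsε)).1)
  · have hμρ : μ ∉ spectrum ℂ (T * (1 - T * B)) := fun hspec =>
      (hrs.trans_le hge).not_ge (mem_closedBall_zero_iff.1 (hres hspec))
    exact isFredholm_of_isUnit (mem_resolventSet_iff.1 (spectrum.mem_resolventSet_iff.2
      (spectrum.notMem_iff.1 hμρ)))

theorem exists_isRiesz_of_eventually_isBrowder (hX : ¬ FiniteDimensional ℂ X)
    (h : ∀ᶠ μ in 𝓝[≠] (0 : ℂ), IsBrowder (ofBounded (T - μ • 1))) :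
    ∃ B, IsCommOuterInverse T B ∧ IsRiesz (T * (1 - T * B)) := by
  by_cases hT : T.IsFredholm
  · have hclosure : (0 : ℂ) ∈ closure (resolventSet ℂ T) := by
      rw [← closure_closure, mem_closure_iff_frequently]
      exact (h.mono fun μ => mem_closure_resolventSet_of_isBrowder).frequently.filter_mono
        nhdsWithin_le_nhds
    exact exists_isRiesz_of_isBrowder hX (isBrowder_ofBounded_of_zero_mem_closure hT hclosure)
  · obtain ⟨ε, hε, hball⟩ := Metric.eventually_nhds_iff.1 (eventually_nhdsWithin_iff.1 h)
    exact exists_isRiesz_of_not_isFredholm hT hε fun μ hμ hμε =>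
      hball (by rwa [dist_zero_right]) hμ

theorem isGeneralizedDrazinRieszInvertible_ofBounded_iff (hX : ¬ FiniteDimensional ℂ X)
    (T : X →L[ℂ] X) :
    IsGeneralizedDrazinRieszInvertible (ofBounded T) ↔
      ¬ AccPt (0 : ℂ) (𝓟 (browderSpectrum (ofBounded T))) := by
  rw [isGeneralizedDrazinRieszInvertible_ofBounded_iff_exists,
    not_accPt_browderSpectrum_ofBounded_iff]
  exact ⟨fun ⟨_, hB, hRiesz⟩ => eventually_isBrowder_of_isRiesz hB hRiesz,
    exists_isRiesz_of_eventually_isBrowder hX⟩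

end Isolated

end UnboundedOp

theorem mainTheorem1 {X : Type*} [NormedAddCommGroup X] [NormedSpace ℂ X] [CompleteSpace X]
    (hX : ¬ FiniteDimensional ℂ X)
    (A : X →ₗ.[ℂ] X) (hclosed : A.IsClosed) (hdense : Dense (A.domain : Set X))
    (hess : (UnboundedOp.essentialResolvent A).Nonempty)
    (hdom : ∀ᶠ j : ℕ in atTop,
      (UnboundedOp.pow A (j + 1)).domain = (UnboundedOp.pow A j).domain) :
    UnboundedOp.IsGeneralizedDrazinRieszInvertible A ↔
      ¬ AccPt (0 : ℂ) (𝓟 (UnboundedOp.browderSpectrum A)) := by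
  obtain ⟨T, rfl⟩ := UnboundedOp.exists_eq_ofBounded hclosed
    (UnboundedOp.domain_eq_top hclosed hdense hess hdom)
  exact UnboundedOp.isGeneralizedDrazinRieszInvertible_ofBounded_iff hX T
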